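/- For $n\ge 1$ let $\mathcal P_n=\{\vartheta\in\mathbb R^n : \vartheta_k>0 \text{ for all } k,\ \sum_{k=1}^n\vartheta_k=1\}$, an $(n-1)$-dimensional smooth manifold. For $\alpha\in\mathbb R$ let $g_\alpha$ be the Riemannian metric on $\mathcal P_n$ obtained by pulling back the Euclidean metric of $\mathbb R^n$ under the map $\phi_\alpha:\mathcal P_n\to\mathbb R^n$, $$\phi_\alpha(\vartheta)=\begin{cases}\frac{2}{1-\alpha}\bigl(\vartheta_1^{\frac{1-\alpha}2},\dots,\vartheta_n^{\frac{1-\alpha}2}\bigr), & \alpha\neq 1,\\ (\log\vartheta_1,\dots,\log\vartheta_n), & \alpha=1.\end{cases}$$ Then for every $\alpha\in\mathbb R$ and every $\vartheta\in\mathcal P_n$ the scalar curvature of $(\mathcal P_n,g_\alpha)$ at $\vartheta$ is $$\mathrm{Scal}(\vartheta)=\frac{(1+\alpha)^2}{4c(\vartheta)^2}\sum_{\substack{t,s=1\\ t\ne s}}^n\vartheta_t^{\alpha}\vartheta_s^{\alpha}\left(1-\frac{\vartheta_t^{\alpha+1}+\vartheta_s^{\alpha+1}}{c(\vartheta)^2}\right),\qquad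 c(\vartheta)=\sqrt{\sum_{k=1}^n\vartheta_k^{\alpha+1}}.$$ The scalar curvature is normalized as the full trace of the Ricci tensor, so that the round sphere of dimension $d$ and radius $R$ has scalar curvature $d(d-1)/R^2$. -/

import Mathlib

open scoped ContDiff

noncomputable section

namespace AlphaGeometry

/-! ### Scalar curvature of a Riemannian metric in local coordinates -/

/-- The partial derivative `∂ᵢ f` of a real function on coordinate space. -/
def partialDeriv {m : ℕ} (i : Fin m) (f : (Fin m → ℝ) → ℝ) (x : Fin m → ℝ) : ℝ :=
  fderiv ℝ f x (Pi.single i 1)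

/-- The Christoffel symbol of the second kind of the Levi-Civita connection,
`Γᵢⱼᵏ = ½ ∑ₗ gᵏˡ (∂ᵢ gⱼₗ + ∂ⱼ gᵢₗ - ∂ₗ gᵢⱼ)`. -/
def christoffel {m : ℕ} (G : (Fin m → ℝ) → Matrix (Fin m) (Fin m) ℝ)
    (i j k : Fin m) (x : Fin m → ℝ) : ℝ :=
  1 / 2 * ∑ l, (G x)⁻¹ k l *
    (partialDeriv i (fun y => G y j l) x + partialDeriv j (fun y => G y i l) x
      - partialDeriv l (fun y => G y i j) x)

/-- The component along `∂ₗ` of `R(∂ᵢ, ∂ⱼ)∂ₖ = ∇ᵢ∇ⱼ∂ₖ - ∇ⱼ∇ᵢ∂ₖ`. -/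
def riemannTensor {m : ℕ} (G : (Fin m → ℝ) → Matrix (Fin m) (Fin m) ℝ)
    (i j k l : Fin m) (x : Fin m → ℝ) : ℝ :=
  partialDeriv i (christoffel G j k l) x - partialDeriv j (christoffel G i k l) x
    + ∑ p, (christoffel G j k p x * christoffel G i p l x
      - christoffel G i k p x * christoffel G j p l x)

/-- The Ricci tensor: `Ric(∂ⱼ, ∂ₖ)` is the trace of `X ↦ R(X, ∂ⱼ)∂ₖ`. -/
def ricciTensor {m : ℕ} (G : (Fin m → ℝ) → Matrix (Fin m) (Fin m) ℝ)
    (j k : Fin m) (x : Fin m → ℝ) : ℝ :=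
  ∑ i, riemannTensor G i j k i x

/-- The scalar curvature `∑ gʲᵏ Ricⱼₖ` of the metric `∑ gᵢⱼ dxᵢ dxⱼ`. -/
def scalarCurvature {m : ℕ} (G : (Fin m → ℝ) → Matrix (Fin m) (Fin m) ℝ)
    (x : Fin m → ℝ) : ℝ :=
  ∑ j, ∑ k, (G x)⁻¹ j k * ricciTensor G j k x

/-! ### The simplex and its Riemannian metrics -/

/-- The open simplex of strictly positive probability distributions on `n` points. -/
def simplex (n : ℕ) : Set (Fin n → ℝ) :=
  {θ | (∀ k, 0 < θ k) ∧ ∑ k, θ k = 1}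

/-- A smooth local parametrization (inverse of a chart) of the `(n - 1)`-dimensional manifold
`simplex n`, defined on the open set `U` of coordinate space. -/
structure IsLocalParametrization (n : ℕ) (U : Set (Fin (n - 1) → ℝ))
    (ψ : (Fin (n - 1) → ℝ) → (Fin n → ℝ)) : Prop where
  isOpen : IsOpen U
  contDiffOn : ContDiffOn ℝ ∞ ψ U
  injOn : Set.InjOn ψ U
  mapsTo : Set.MapsTo ψ U (simplex n)
  immersion : ∀ x ∈ U, Function.Injective (fderiv ℝ ψ x)

/-- The coordinate matrix `gᵢⱼ(x) = g(∂ᵢψ, ∂ⱼψ)` in the parametrization `ψ` of a metric `g`,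
where `g θ a b` is the inner product of the tangent vectors `a, b` at `θ`. -/
def metricMatrix {m n : ℕ} (g : (Fin n → ℝ) → (Fin n → ℝ) → (Fin n → ℝ) → ℝ)
    (ψ : (Fin m → ℝ) → (Fin n → ℝ)) (x : Fin m → ℝ) : Matrix (Fin m) (Fin m) ℝ :=
  Matrix.of fun i j =>
    g (ψ x) (fderiv ℝ ψ x (Pi.single i 1)) (fderiv ℝ ψ x (Pi.single j 1))

/-- `s` is the scalar curvature at `θ` of the simplex with the Riemannian metric `g`: there are
local coordinates around `θ`, and in all of them the scalar curvature at `θ` is `s`. -/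
def IsScalarCurvatureAt {n : ℕ} (g : (Fin n → ℝ) → (Fin n → ℝ) → (Fin n → ℝ) → ℝ)
    (θ : Fin n → ℝ) (s : ℝ) : Prop :=
  (∃ U ψ, IsLocalParametrization n U ψ ∧ ∃ x ∈ U, ψ x = θ) ∧
  ∀ U ψ, IsLocalParametrization n U ψ → ∀ x ∈ U, ψ x = θ →
    scalarCurvature (metricMatrix g ψ) x = s

/-- The map `φ_α`, on all positive (not necessarily normalized) vectors. -/
def alphaMap {n : ℕ} (α : ℝ) (θ : Fin n → ℝ) : Fin n → ℝ := fun k =>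
  if α = 1 then Real.log (θ k) else 2 / (1 - α) * θ k ^ ((1 - α) / 2)

/-- The metric `g_α`: the pull-back of the Euclidean metric under `φ_α`. -/
def alphaMetric {n : ℕ} (α : ℝ) (θ a b : Fin n → ℝ) : ℝ :=
  ∑ k, fderiv ℝ (alphaMap α) θ a k * fderiv ℝ (alphaMap α) θ b k

/-- The normalization `c(θ)`. -/
def normConst {n : ℕ} (α : ℝ) (θ : Fin n → ℝ) : ℝ :=
  Real.sqrt (∑ k, θ k ^ (α + 1))

end AlphaGeometry

end

/-!
The map `φ_α` realizes the simplex with the metric `g_α` as a hypersurface of Euclidean space.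
The field `N = (θₖ ^ ((1 + α) / 2))ₖ` is normal to it, since `∂φ_α = θ ^ (-(1 + α) / 2) ∂θ` and
`∑ ∂θₖ = 0`; it has length `c(θ)`, and its derivative along the hypersurface is the diagonal matrix
`D = diag ((1 + α) / 2 * θₖ ^ α)`. With `P = 1 - N Nᵀ / |N|²` the orthogonal projection onto the
tangent space, the Gauss equation gives `Scal = (tr (D P) ² - tr (D P D P)) / |N|²`. The term with
indices `t = s` vanishes in the difference of the two traces, and for `t ≠ s` one has
`Pₜₜ Pₛₛ - Pₜₛ² = 1 - (Nₜ² + Nₛ²) / |N|²`.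
-/

noncomputable section

namespace AlphaGeometry

open Matrix Module
open scoped InnerProductSpace Topology

/-- The partial derivative `∂ᵢ f` of a vector-valued function on coordinate space, written
`∂ i f`. It extends `partialDeriv`, with which it agrees definitionally on real functions. -/
def vecPartialDeriv {m : ℕ} {E : Type*} [NormedAddCommGroup E] [NormedSpace ℝ E] (i : Fin m)
    (f : (Fin m → ℝ) → E) (x : Fin m → ℝ) : E :=
  fderiv ℝ f x (Pi.single i 1)

local notation "∂" => vecPartialDeriv

section PartialDerivatives

variable {m : ℕ} {E : Type*} [NormedAddCommGroup E] {x : Fin m → ℝ}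

section NormedSpace

variable [NormedSpace ℝ E] {f g : (Fin m → ℝ) → E}

theorem contDiffAt_vecPartialDeriv {r s : WithTop ℕ∞} (hf : ContDiffAt ℝ s f x) (hrs : r + 1 ≤ s)
    (i : Fin m) : ContDiffAt ℝ r (∂ i f) x :=
  (hf.fderiv_right hrs).clm_apply contDiffAt_const

theorem vecPartialDeriv_comm (hf : ContDiffAt ℝ 2 f x) (i j : Fin m) :
    ∂ i (∂ j f) x = ∂ j (∂ i f) x := by
  have hdf : DifferentiableAt ℝ (fderiv ℝ f) x :=
    (hf.fderiv_right (m := 1) (by norm_num)).differentiableAt (by norm_num)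
  have fderiv_apply (v w : Fin m → ℝ) :
      fderiv ℝ (fun y => fderiv ℝ f y v) x w = fderiv ℝ (fderiv ℝ f) x w v := by
    simp [fderiv_clm_apply hdf (differentiableAt_const v)]
  have hsymm : IsSymmSndFDerivAt ℝ f x := hf.isSymmSndFDerivAt (by simp)
  exact (fderiv_apply _ _).trans ((hsymm _ _).trans (fderiv_apply _ _).symm)

theorem vecPartialDeriv_comp {F : Type*} [NormedAddCommGroup F] [NormedSpace ℝ F] {g : E → F}
    (hg : DifferentiableAt ℝ g (f x)) (hf : DifferentiableAt ℝ f x) (i : Fin m) :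
    ∂ i (g ∘ f) x = fderiv ℝ g (f x) (∂ i f x) := by
  simp [vecPartialDeriv, fderiv_comp x hg hf]

theorem vecPartialDeriv_sub (hf : DifferentiableAt ℝ f x) (hg : DifferentiableAt ℝ g x)
    (i : Fin m) : ∂ i (fun y => f y - g y) x = ∂ i f x - ∂ i g x := by
  simp [vecPartialDeriv, fderiv_fun_sub hf hg]

theorem vecPartialDeriv_sum_smul {ι : Type*} [Fintype ι] {c : ι → (Fin m → ℝ) → ℝ}
    {v : ι → (Fin m → ℝ) → E} (hc : ∀ p, DifferentiableAt ℝ (c p) x)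
    (hv : ∀ p, DifferentiableAt ℝ (v p) x) (i : Fin m) :
    ∂ i (fun y => ∑ p, c p y • v p y) x
      = ∑ p, (partialDeriv i (c p) x • v p x + c p x • ∂ i (v p) x) := by
  simp [vecPartialDeriv, partialDeriv, fderiv_fun_sum fun p _ => (hc p).fun_smul (hv p),
    fderiv_fun_smul (hc _) (hv _), add_comm]

end NormedSpace

section InnerProductSpace

variable [InnerProductSpace ℝ E] {f g : (Fin m → ℝ) → E}

theorem partialDeriv_inner (hf : DifferentiableAt ℝ f x) (hg : DifferentiableAt ℝ g x)
    (i : Fin m) :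
    partialDeriv i (fun y => ⟪f y, g y⟫_ℝ) x = ⟪∂ i f x, g x⟫_ℝ + ⟪f x, ∂ i g x⟫_ℝ := by
  rw [add_comm]
  exact fderiv_inner_apply ℝ hf hg _

theorem inner_vecPartialDeriv_of_orthogonal (hf : DifferentiableAt ℝ f x)
    (hg : DifferentiableAt ℝ g x) (h : ∀ᶠ y in 𝓝 x, ⟪f y, g y⟫_ℝ = 0) (i : Fin m) :
    ⟪∂ i f x, g x⟫_ℝ = -⟪f x, ∂ i g x⟫_ℝ := by
  have hzero : partialDeriv i (fun y => ⟪f y, g y⟫_ℝ) x = 0 := by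
    have : (fun y => ⟪f y, g y⟫_ℝ) =ᶠ[𝓝 x] fun _ => 0 := h
    simp [partialDeriv, this.fderiv_eq]
  rw [partialDeriv_inner hf hg] at hzero
  linarith

end InnerProductSpace

end PartialDerivatives

section Congruence

variable {m : ℕ} {G G' : (Fin m → ℝ) → Matrix (Fin m) (Fin m) ℝ} {x : Fin m → ℝ}

theorem christoffel_eventuallyEq (h : G =ᶠ[𝓝 x] G') (i j k : Fin m) :
    christoffel G i j k =ᶠ[𝓝 x] christoffel G' i j k := by
  filter_upwards [h.eventuallyEq_nhds] with y hy
  have hentry (a b : Fin m) : (fun z => G z a b) =ᶠ[𝓝 y] fun z => G' z a b :=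
    hy.fun_comp fun M => M a b
  simp only [christoffel, partialDeriv, hy.eq_of_nhds, (hentry _ _).fderiv_eq]

theorem scalarCurvature_congr (h : G =ᶠ[𝓝 x] G') : scalarCurvature G x = scalarCurvature G' x := by
  have hΓ := christoffel_eventuallyEq h
  simp only [scalarCurvature, ricciTensor, riemannTensor, partialDeriv, h.eq_of_nhds,
    (hΓ _ _ _).fderiv_eq, (hΓ _ _ _).eq_of_nhds]

end Congruence

open scoped Matrix.Norms.Operator in
theorem differentiableAt_matrix_inv_apply {κ : Type*} [Fintype κ]
    [DecidableEq κ] {F : Type*} [NormedAddCommGroup F] [NormedSpace ℝ F]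
    {M : F → Matrix κ κ ℝ} {x : F}
    (hM : ∀ i j, DifferentiableAt ℝ (fun y => M y i j) x) (hunit : IsUnit (M x)) (i j : κ) :
    DifferentiableAt ℝ (fun y => (M y)⁻¹ i j) x := by
  have hM' : DifferentiableAt ℝ M x :=
    differentiableAt_pi.2 fun i => differentiableAt_pi.2 fun j => hM i j
  simp only [nonsing_inv_eq_ringInverse]
  exact differentiableAt_pi.1 (differentiableAt_pi.1 (hM'.inverse hunit) i) j

section Gauss

variable {m : ℕ} {E : Type*} [NormedAddCommGroup E] [InnerProductSpace ℝ E]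

/-- The first fundamental form of `f` in coordinates, `gᵢⱼ = ⟪∂ᵢf, ∂ⱼf⟫`: the pull-back of the
metric of the ambient space. -/
def inducedMetric (f : (Fin m → ℝ) → E) (x : Fin m → ℝ) : Matrix (Fin m) (Fin m) ℝ :=
  gram ℝ fun i => ∂ i f x

/-- The vector-valued second fundamental form `II(∂ⱼ, ∂ₖ) = ∂ⱼ∂ₖf - ∑ₚ Γⱼₖᵖ ∂ₚf`, the difference
between the flat derivative of the ambient space and the Levi-Civita connection of the induced
metric. -/
def secondFundamentalForm (f : (Fin m → ℝ) → E) (j k : Fin m) (x : Fin m → ℝ) : E :=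
  ∂ j (∂ k f) x - ∑ p, christoffel (inducedMetric f) j k p x • ∂ p f x

variable {f : (Fin m → ℝ) → E} {x : Fin m → ℝ}

theorem differentiableAt_vecPartialDeriv (hf : ContDiffAt ℝ 2 f x) (i : Fin m) :
    DifferentiableAt ℝ (∂ i f) x :=
  (contDiffAt_vecPartialDeriv (r := 1) hf (by norm_num) i).differentiableAt (by norm_num)

theorem eventually_linearIndependent_vecPartialDeriv (hf : ContDiffAt ℝ 1 f x)
    (hli : LinearIndependent ℝ fun i => ∂ i f x) :
    ∀ᶠ y in 𝓝 x, LinearIndependent ℝ fun i => ∂ i f y :=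
  (continuousAt_pi.2 fun i => (contDiffAt_vecPartialDeriv (r := 0) hf (by norm_num) i).continuousAt
    ).eventually hli.eventually

theorem isUnit_inducedMetric (hli : LinearIndependent ℝ fun i => ∂ i f x) :
    IsUnit (inducedMetric f x) :=
  (posDef_gram_of_linearIndependent hli).isUnit

theorem inducedMetric_comm (i j : Fin m) : inducedMetric f x i j = inducedMetric f x j i :=
  real_inner_comm _ _

theorem partialDeriv_inducedMetric (hf : ContDiffAt ℝ 2 f x) (i j l : Fin m) :
    partialDeriv i (fun y => inducedMetric f y j l) x
      = ⟪∂ i (∂ j f) x, ∂ l f x⟫_ℝ + ⟪∂ j f x, ∂ i (∂ l f) x⟫_ℝ :=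
  partialDeriv_inner (differentiableAt_vecPartialDeriv hf j)
    (differentiableAt_vecPartialDeriv hf l) i

theorem christoffel_inducedMetric (hf : ContDiffAt ℝ 2 f x) (i j k : Fin m) :
    christoffel (inducedMetric f) i j k x
      = ((inducedMetric f x)⁻¹ *ᵥ fun l => ⟪∂ i (∂ j f) x, ∂ l f x⟫_ℝ) k := by
  rw [christoffel, Finset.mul_sum, mulVec, dotProduct]
  refine Finset.sum_congr rfl fun l _ => ?_
  simp only [partialDeriv_inducedMetric hf, vecPartialDeriv_comm hf j i,
    vecPartialDeriv_comm hf l i, vecPartialDeriv_comm hf l j, real_inner_comm (∂ i (∂ l f) x),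
    real_inner_comm (∂ j (∂ l f) x)]
  ring

theorem sum_christoffel_mul_inducedMetric (hf : ContDiffAt ℝ 2 f x)
    (hli : LinearIndependent ℝ fun i => ∂ i f x) (j k q : Fin m) :
    ∑ p, christoffel (inducedMetric f) j k p x * inducedMetric f x p q
      = ⟪∂ j (∂ k f) x, ∂ q f x⟫_ℝ := by
  have hdet := (isUnit_iff_isUnit_det _).1 (isUnit_inducedMetric hli)
  calc ∑ p, christoffel (inducedMetric f) j k p x * inducedMetric f x p q
      = (inducedMetric f x *ᵥ (inducedMetric f x)⁻¹ *ᵥ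
          fun l => ⟪∂ j (∂ k f) x, ∂ l f x⟫_ℝ) q := by
        rw [mulVec, dotProduct]
        simp only [christoffel_inducedMetric hf, inducedMetric_comm _ q, mul_comm]
    _ = ⟪∂ j (∂ k f) x, ∂ q f x⟫_ℝ := by
        rw [mulVec_mulVec, mul_nonsing_inv _ hdet, one_mulVec]

theorem inner_secondFundamentalForm_vecPartialDeriv (hf : ContDiffAt ℝ 2 f x)
    (hli : LinearIndependent ℝ fun i => ∂ i f x) (j k q : Fin m) :
    ⟪secondFundamentalForm f j k x, ∂ q f x⟫_ℝ = 0 := by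
  simp only [secondFundamentalForm, inner_sub_left, sum_inner, real_inner_smul_left]
  exact sub_eq_zero.2 (sum_christoffel_mul_inducedMetric hf hli j k q).symm

theorem inner_secondFundamentalForm_vecPartialDeriv_vecPartialDeriv (hf : ContDiffAt ℝ 2 f x)
    (hli : LinearIndependent ℝ fun i => ∂ i f x) (j k i q : Fin m) :
    ⟪secondFundamentalForm f j k x, ∂ i (∂ q f) x⟫_ℝ
      = ⟪secondFundamentalForm f j k x, secondFundamentalForm f i q x⟫_ℝ := by
  rw [secondFundamentalForm.eq_1 f i q, inner_sub_right, inner_sum]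
  simp only [real_inner_smul_right, inner_secondFundamentalForm_vecPartialDeriv hf hli, mul_zero,
    Finset.sum_const_zero, sub_zero]

theorem differentiableAt_christoffel_inducedMetric (hf : ContDiffAt ℝ 3 f x)
    (hli : LinearIndependent ℝ fun i => ∂ i f x) (i j k : Fin m) :
    DifferentiableAt ℝ (christoffel (inducedMetric f) i j k) x := by
  have hmetric (a b : Fin m) : ContDiffAt ℝ 2 (fun y => inducedMetric f y a b) x :=
    (contDiffAt_vecPartialDeriv hf (by norm_num) a).inner ℝ
      (contDiffAt_vecPartialDeriv hf (by norm_num) b)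
  have hpartial (a b c : Fin m) :
      DifferentiableAt ℝ (partialDeriv a fun y => inducedMetric f y b c) x :=
    differentiableAt_vecPartialDeriv (hmetric b c) a
  have hinv := differentiableAt_matrix_inv_apply
    (fun a b => (hmetric a b).differentiableAt (by norm_num)) (isUnit_inducedMetric hli)
  exact (DifferentiableAt.fun_sum fun l _ => (hinv k l).fun_mul
    (((hpartial i j l).fun_add (hpartial j i l)).fun_sub (hpartial l i j))).const_mul _

theorem vecPartialDeriv_secondFundamentalForm (hf : ContDiffAt ℝ 3 f x)
    (hli : LinearIndependent ℝ fun i => ∂ i f x) (i j k : Fin m) :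
    ∂ i (secondFundamentalForm f j k) x = ∂ i (∂ j (∂ k f)) x
      - ∑ p, (partialDeriv i (christoffel (inducedMetric f) j k p) x • ∂ p f x
        + christoffel (inducedMetric f) j k p x • ∂ i (∂ p f) x) := by
  have hΓ := differentiableAt_christoffel_inducedMetric hf hli
  have hdf (p : Fin m) : ContDiffAt ℝ 2 (∂ p f) x :=
    contDiffAt_vecPartialDeriv hf (by norm_num) p
  have hdf' (p : Fin m) : DifferentiableAt ℝ (∂ p f) x := (hdf p).differentiableAt (by norm_num)
  rw [← vecPartialDeriv_sum_smul (fun p => hΓ j k p) hdf']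
  exact vecPartialDeriv_sub (differentiableAt_vecPartialDeriv (hdf k) j)
    (.fun_sum fun p _ => (hΓ j k p).fun_smul (hdf' p)) i

theorem differentiableAt_secondFundamentalForm (hf : ContDiffAt ℝ 3 f x)
    (hli : LinearIndependent ℝ fun i => ∂ i f x) (j k : Fin m) :
    DifferentiableAt ℝ (secondFundamentalForm f j k) x :=
  (differentiableAt_vecPartialDeriv (contDiffAt_vecPartialDeriv hf (by norm_num) k) j).fun_sub <|
    .fun_sum fun p _ => (differentiableAt_christoffel_inducedMetric hf hli j k p).fun_smul
      (differentiableAt_vecPartialDeriv (hf.of_le (by norm_num)) p)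

theorem inner_vecPartialDeriv_secondFundamentalForm (hf : ContDiffAt ℝ 3 f x)
    (hli : LinearIndependent ℝ fun i => ∂ i f x) (i j k q : Fin m) :
    ⟪∂ i (secondFundamentalForm f j k) x, ∂ q f x⟫_ℝ
      = -⟪secondFundamentalForm f j k x, secondFundamentalForm f i q x⟫_ℝ := by
  have hf₂ : ContDiffAt ℝ 2 f x := hf.of_le (by norm_num)
  rw [← inner_secondFundamentalForm_vecPartialDeriv_vecPartialDeriv hf₂ hli]
  refine inner_vecPartialDeriv_of_orthogonal (differentiableAt_secondFundamentalForm hf hli j k)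
    (differentiableAt_vecPartialDeriv hf₂ q) ?_ i
  filter_upwards [hf₂.eventually (by simp),
    eventually_linearIndependent_vecPartialDeriv (hf.of_le (by norm_num)) hli] with y hfy hliy
  exact inner_secondFundamentalForm_vecPartialDeriv hfy hliy j k q

theorem sum_riemannTensor_smul_vecPartialDeriv (hf : ContDiffAt ℝ 3 f x)
    (hli : LinearIndependent ℝ fun i => ∂ i f x) (i j k : Fin m) :
    ∑ l, riemannTensor (inducedMetric f) i j k l x • ∂ l f x
      = ∂ j (secondFundamentalForm f i k) x - ∂ i (secondFundamentalForm f j k) x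
        + ∑ p, (christoffel (inducedMetric f) i k p x • secondFundamentalForm f j p x
          - christoffel (inducedMetric f) j k p x • secondFundamentalForm f i p x) := by
  have hcomm : ∂ i (∂ j (∂ k f)) x = ∂ j (∂ i (∂ k f)) x :=
    vecPartialDeriv_comm (contDiffAt_vecPartialDeriv hf (by norm_num) k) i j
  have hswap (a b : Fin m) :
      ∑ l, (∑ p, christoffel (inducedMetric f) a k p x * christoffel (inducedMetric f) b p l x)
          • ∂ l f x
        = ∑ p, christoffel (inducedMetric f) a k p x •
          ∑ l, christoffel (inducedMetric f) b p l x • ∂ l f x := by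
    simp only [Finset.sum_smul, Finset.smul_sum, smul_smul]
    exact Finset.sum_comm
  simp only [vecPartialDeriv_secondFundamentalForm hf hli, hcomm, riemannTensor,
    secondFundamentalForm, add_smul, sub_smul, smul_sub, Finset.sum_add_distrib,
    Finset.sum_sub_distrib, hswap]
  abel

theorem gauss_equation (hf : ContDiffAt ℝ 3 f x) (hli : LinearIndependent ℝ fun i => ∂ i f x)
    (i j k q : Fin m) :
    ∑ l, riemannTensor (inducedMetric f) i j k l x * inducedMetric f x l q
      = ⟪secondFundamentalForm f j k x, secondFundamentalForm f i q x⟫_ℝ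
        - ⟪secondFundamentalForm f i k x, secondFundamentalForm f j q x⟫_ℝ := by
  have hnormal := inner_secondFundamentalForm_vecPartialDeriv (hf.of_le (by norm_num)) hli
  calc ∑ l, riemannTensor (inducedMetric f) i j k l x * inducedMetric f x l q
      = ⟪∑ l, riemannTensor (inducedMetric f) i j k l x • ∂ l f x, ∂ q f x⟫_ℝ := by
        simp only [sum_inner, real_inner_smul_left]
        rfl
    _ = _ := by
        rw [sum_riemannTensor_smul_vecPartialDeriv hf hli]
        simp only [inner_add_left, inner_sub_left, sum_inner, real_inner_smul_left, hnormal,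
          inner_vecPartialDeriv_secondFundamentalForm hf hli, mul_zero, sub_zero,
          Finset.sum_const_zero]
        ring

theorem riemannTensor_inducedMetric (hf : ContDiffAt ℝ 3 f x)
    (hli : LinearIndependent ℝ fun i => ∂ i f x) (i j k l : Fin m) :
    riemannTensor (inducedMetric f) i j k l x
      = ∑ q, (⟪secondFundamentalForm f j k x, secondFundamentalForm f i q x⟫_ℝ
        - ⟪secondFundamentalForm f i k x, secondFundamentalForm f j q x⟫_ℝ)
          * (inducedMetric f x)⁻¹ q l := by
  have hdet := (isUnit_iff_isUnit_det _).1 (isUnit_inducedMetric hli)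
  set R : Fin m → ℝ := fun l => riemannTensor (inducedMetric f) i j k l x
  calc R l = (R ᵥ* inducedMetric f x ᵥ* (inducedMetric f x)⁻¹) l := by
        rw [vecMul_vecMul, mul_nonsing_inv _ hdet, vecMul_one]
    _ = _ := by
        simp only [← gauss_equation hf hli]
        rfl

theorem scalarCurvature_inducedMetric (hf : ContDiffAt ℝ 3 f x)
    (hli : LinearIndependent ℝ fun i => ∂ i f x) :
    scalarCurvature (inducedMetric f) x
      = ∑ j, ∑ k, ∑ i, ∑ q, (inducedMetric f x)⁻¹ j k * (inducedMetric f x)⁻¹ i q *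
        (⟪secondFundamentalForm f j k x, secondFundamentalForm f i q x⟫_ℝ
          - ⟪secondFundamentalForm f i k x, secondFundamentalForm f j q x⟫_ℝ) := by
  have hsymm (i q : Fin m) : (inducedMetric f x)⁻¹ q i = (inducedMetric f x)⁻¹ i q :=
    (isHermitian_gram ℝ fun i => ∂ i f x).inv.apply i q
  simp only [scalarCurvature, ricciTensor, riemannTensor_inducedMetric hf hli, Finset.mul_sum,
    hsymm]
  simp only [mul_comm, mul_left_comm]

end Gauss

section Codimension

variable {κ E : Type*} [Fintype κ] [NormedAddCommGroup E] [InnerProductSpace ℝ E] {e : κ → E}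
  {N : E}

theorem eq_inner_div_norm_sq_smul_of_orthogonal (hrank : finrank ℝ E = Fintype.card κ + 1)
    (he : LinearIndependent ℝ e) (hN : N ≠ 0) (hNe : ∀ i, ⟪N, e i⟫_ℝ = 0) {w : E}
    (hwe : ∀ i, ⟪w, e i⟫_ℝ = 0) : w = (⟪N, w⟫_ℝ / ‖N‖ ^ 2) • N := by
  have : FiniteDimensional ℝ E := .of_finrank_pos (by omega)
  set K := Submodule.span ℝ (Set.range e)
  have mem_orthogonal {u : E} (hu : ∀ i, ⟪u, e i⟫_ℝ = 0) : u ∈ Kᗮ := by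
    refine (Submodule.mem_orthogonal' K u).2 fun v hv => ?_
    induction hv using Submodule.span_induction with
    | mem v hv => obtain ⟨i, rfl⟩ := hv; exact hu i
    | zero => exact inner_zero_right u
    | add v v' _ _ hv hv' => rw [inner_add_right, hv, hv', add_zero]
    | smul c v _ hv => rw [inner_smul_right, hv, mul_zero]
  have hline : finrank ℝ Kᗮ = 1 := by
    have hK : finrank ℝ K = Fintype.card κ := finrank_span_eq_card he
    have hadd := K.finrank_add_finrank_orthogonal
    omega
  obtain ⟨c, hc⟩ := (finrank_eq_one_iff_of_nonzero' (⟨N, mem_orthogonal hNe⟩ : Kᗮ)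
    (by simpa using hN)).1 hline ⟨w, mem_orthogonal hwe⟩
  obtain rfl : c • N = w := congrArg Subtype.val hc
  rw [inner_smul_right, real_inner_self_eq_norm_sq,
    mul_div_cancel_right₀ _ (pow_ne_zero 2 (norm_ne_zero_iff.2 hN))]

theorem sum_gram_inv_mul_inner_smul [DecidableEq κ] (hrank : finrank ℝ E = Fintype.card κ + 1)
    (he : LinearIndependent ℝ e) (hN : N ≠ 0) (hNe : ∀ i, ⟪N, e i⟫_ℝ = 0) (v : E) :
    ∑ k, ((gram ℝ e)⁻¹ *ᵥ fun j => ⟪e j, v⟫_ℝ) k • e k = v - (⟪N, v⟫_ℝ / ‖N‖ ^ 2) • N := by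
  have hdet := (isUnit_iff_isUnit_det _).1 (posDef_gram_of_linearIndependent he).isUnit
  set c := (gram ℝ e)⁻¹ *ᵥ fun j => ⟪e j, v⟫_ℝ with hc
  have hproj (i : κ) : ⟪e i, ∑ k, c k • e k⟫_ℝ = ⟪e i, v⟫_ℝ := by
    calc ⟪e i, ∑ k, c k • e k⟫_ℝ = (gram ℝ e *ᵥ c) i := by
          simp only [inner_sum, real_inner_smul_right, mulVec, dotProduct, gram_apply, mul_comm]
      _ = ⟪e i, v⟫_ℝ := by rw [hc, mulVec_mulVec, mul_nonsing_inv _ hdet, one_mulVec]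
  have hnormal := eq_inner_div_norm_sq_smul_of_orthogonal hrank he hN hNe
    (w := v - ∑ k, c k • e k) fun i => by
      rw [real_inner_comm, inner_sub_right, hproj, sub_self]
  simp only [inner_sub_right, inner_sum, real_inner_smul_right, hNe, mul_zero,
    Finset.sum_const_zero, sub_zero] at hnormal
  rw [← hnormal, sub_sub_cancel]

theorem mul_gram_inv_mul_transpose_apply {ι : Type*} [Fintype ι] [DecidableEq ι] [DecidableEq κ]
    {e : κ → EuclideanSpace ℝ ι} {N : EuclideanSpace ℝ ι}
    (hcard : Fintype.card ι = Fintype.card κ + 1) (he : LinearIndependent ℝ e) (hN : N ≠ 0)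
    (hNe : ∀ i, ⟪N, e i⟫_ℝ = 0) (t s : ι) :
    ((of fun t k => e k t) * (gram ℝ e)⁻¹ * (of fun t k => e k t)ᵀ) t s
      = (1 : Matrix ι ι ℝ) t s - N t * N s / ‖N‖ ^ 2 := by
  calc ((of fun t k => e k t) * (gram ℝ e)⁻¹ * (of fun t k => e k t)ᵀ) t s
      = (∑ k, ((gram ℝ e)⁻¹ *ᵥ fun j => ⟪e j, EuclideanSpace.single s 1⟫_ℝ) k • e k) t := by
        rw [Matrix.mul_assoc, mul_apply]
        simp [mul_apply, mulVec, dotProduct, EuclideanSpace.inner_single_right, mul_comm]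
    _ = (1 : Matrix ι ι ℝ) t s - N t * N s / ‖N‖ ^ 2 := by
        rw [sum_gram_inv_mul_inner_smul (by simpa using hcard) he hN hNe]
        simp [one_apply, EuclideanSpace.inner_single_right, mul_comm, mul_div_assoc]

end Codimension

section Trace

variable {κ R : Type*} [Fintype κ] [CommRing R]

theorem sum_mul_mul_sub_eq_trace_sq_sub (H B : Matrix κ κ R) :
    ∑ j, ∑ k, ∑ i, ∑ q, H j k * H i q * (B j k * B i q - B i k * B j q)
      = trace (B * Hᵀ) ^ 2 - trace (B * Hᵀ * (B * Hᵀ)) := by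
  have hsq : trace (B * Hᵀ) ^ 2 = ∑ j, ∑ k, ∑ i, ∑ q, H j k * H i q * (B j k * B i q) := by
    have htr : trace (B * Hᵀ) = ∑ j, ∑ k, H j k * B j k := by
      simp only [trace, diag, mul_apply, transpose_apply, mul_comm]
    rw [pow_two, htr]
    simp only [Finset.sum_mul]
    simp only [Finset.mul_sum, mul_mul_mul_comm]
  have htr_sq : trace (B * Hᵀ * (B * Hᵀ))
      = ∑ j, ∑ k, ∑ i, ∑ q, H j k * H i q * (B i k * B j q) := by
    calc trace (B * Hᵀ * (B * Hᵀ))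
        = ∑ i, ∑ j, ∑ k, ∑ q, B i k * H j k * (B j q * H i q) := by
          simp only [trace, diag, mul_apply (M := B * Hᵀ), mul_apply (M := B), transpose_apply,
            Finset.sum_mul_sum]
      _ = ∑ j, ∑ k, ∑ i, ∑ q, B i k * H j k * (B j q * H i q) := by
          rw [Finset.sum_comm]
          exact Finset.sum_congr rfl fun j _ => Finset.sum_comm
      _ = _ := by
          simp only [mul_comm (B _ _) (H _ _), mul_mul_mul_comm]
  simp only [hsq, htr_sq, mul_sub, Finset.sum_sub_distrib]

theorem trace_sq_sub_trace_transpose_mul_diagonal_mul {ι : Type*} [Fintype ι] [DecidableEq ι]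
    (A : Matrix ι κ R) (d : ι → R) (H : Matrix κ κ R) :
    trace (Aᵀ * diagonal d * A * H) ^ 2
        - trace (Aᵀ * diagonal d * A * H * (Aᵀ * diagonal d * A * H))
      = ∑ t, ∑ s, d t * d s * ((A * H * Aᵀ) t t * (A * H * Aᵀ) s s
        - (A * H * Aᵀ) t s * (A * H * Aᵀ) s t) := by
  set P := A * H * Aᵀ with hP
  have htrace : trace (Aᵀ * diagonal d * A * H) = trace (diagonal d * P) := by
    rw [Matrix.mul_assoc, Matrix.mul_assoc, trace_mul_comm, hP]
    simp only [Matrix.mul_assoc]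
  have htrace_sq : trace (Aᵀ * diagonal d * A * H * (Aᵀ * diagonal d * A * H))
      = trace (diagonal d * P * (diagonal d * P)) := by
    simp only [Matrix.mul_assoc, hP]
    rw [trace_mul_comm]
    simp only [Matrix.mul_assoc]
  rw [htrace, htrace_sq]
  simp only [pow_two, trace, diag, mul_apply (M := diagonal d * P), diagonal_mul,
    Finset.sum_mul_sum, ← Finset.sum_sub_distrib]
  refine Finset.sum_congr rfl fun t _ => Finset.sum_congr rfl fun s _ => ?_
  ring

end Trace

section Hypersurface

variable {m : ℕ} {E : Type*} [NormedAddCommGroup E] [InnerProductSpace ℝ E]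
  {f : (Fin m → ℝ) → E} {x : Fin m → ℝ}

/-- The scalar second fundamental form of the hypersurface `f` with respect to a normal vector `N`
at `x`. The vector `N` need not have length one. -/
def scalarSecondFundamentalForm (f : (Fin m → ℝ) → E) (N : E) (x : Fin m → ℝ) :
    Matrix (Fin m) (Fin m) ℝ :=
  of fun j k => ⟪N, ∂ j (∂ k f) x⟫_ℝ

theorem secondFundamentalForm_eq_smul {N : E} (hrank : finrank ℝ E = m + 1)
    (hf : ContDiffAt ℝ 2 f x) (hli : LinearIndependent ℝ fun i => ∂ i f x) (hN : N ≠ 0)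
    (hNf : ∀ i, ⟪N, ∂ i f x⟫_ℝ = 0) (j k : Fin m) :
    secondFundamentalForm f j k x = (scalarSecondFundamentalForm f N x j k / ‖N‖ ^ 2) • N := by
  have hinner : ⟪N, secondFundamentalForm f j k x⟫_ℝ = scalarSecondFundamentalForm f N x j k := by
    simp only [secondFundamentalForm, inner_sub_right, inner_sum, real_inner_smul_right, hNf,
      mul_zero, Finset.sum_const_zero, sub_zero, scalarSecondFundamentalForm, of_apply]
  rw [← hinner]
  exact eq_inner_div_norm_sq_smul_of_orthogonal (by simpa using hrank) hli hN hNf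
    (inner_secondFundamentalForm_vecPartialDeriv hf hli j k)

theorem scalarCurvature_hypersurface {N : E} (hrank : finrank ℝ E = m + 1)
    (hf : ContDiffAt ℝ 3 f x) (hli : LinearIndependent ℝ fun i => ∂ i f x) (hN : N ≠ 0)
    (hNf : ∀ i, ⟪N, ∂ i f x⟫_ℝ = 0) :
    scalarCurvature (inducedMetric f) x
      = (trace (scalarSecondFundamentalForm f N x * (inducedMetric f x)⁻¹) ^ 2
        - trace (scalarSecondFundamentalForm f N x * (inducedMetric f x)⁻¹
          * (scalarSecondFundamentalForm f N x * (inducedMetric f x)⁻¹))) / ‖N‖ ^ 2 := by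
  have hII := secondFundamentalForm_eq_smul hrank (hf.of_le (by norm_num)) hli hN hNf
  have hinner (j k i q : Fin m) :
      ⟪secondFundamentalForm f j k x, secondFundamentalForm f i q x⟫_ℝ
        = scalarSecondFundamentalForm f N x j k * scalarSecondFundamentalForm f N x i q
          / ‖N‖ ^ 2 := by
    rw [hII, hII, real_inner_smul_left, real_inner_smul_right, real_inner_self_eq_norm_sq]
    field_simp [norm_ne_zero_iff.2 hN]
  have hsymm : (inducedMetric f x)⁻¹ᵀ = (inducedMetric f x)⁻¹ :=
    (isHermitian_gram ℝ fun i => ∂ i f x).inv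
  have htrace := sum_mul_mul_sub_eq_trace_sq_sub (inducedMetric f x)⁻¹
    (scalarSecondFundamentalForm f N x)
  rw [hsymm] at htrace
  simp only [scalarCurvature_inducedMetric hf hli, hinner, ← htrace, Finset.sum_div,
    ← mul_div_assoc, ← sub_div]

theorem scalarSecondFundamentalForm_eq_neg_inner {ν : (Fin m → ℝ) → E}
    (hf : ContDiffAt ℝ 2 f x) (hν : DifferentiableAt ℝ ν x)
    (hνf : ∀ᶠ y in 𝓝 x, ∀ k, ⟪ν y, ∂ k f y⟫_ℝ = 0) (j k : Fin m) :
    scalarSecondFundamentalForm f (ν x) x j k = -⟪∂ j ν x, ∂ k f x⟫_ℝ := by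
  rw [inner_vecPartialDeriv_of_orthogonal hν (differentiableAt_vecPartialDeriv hf k)
    (hνf.mono fun y hy => hy k), neg_neg, scalarSecondFundamentalForm, of_apply]

end Hypersurface

section DiagonalShapeOperator

variable {m : ℕ} {ι : Type*} [Fintype ι] [DecidableEq ι] {f ν : (Fin m → ℝ) → EuclideanSpace ℝ ι}
  {x : Fin m → ℝ} {d : ι → ℝ}

theorem scalarSecondFundamentalForm_of_diagonal (hf : ContDiffAt ℝ 2 f x)
    (hν : DifferentiableAt ℝ ν x) (hνf : ∀ᶠ y in 𝓝 x, ∀ k, ⟪ν y, ∂ k f y⟫_ℝ = 0)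
    (hd : ∀ j t, ∂ j ν x t = d t * ∂ j f x t) :
    scalarSecondFundamentalForm f (ν x) x
      = -((of fun t k => ∂ k f x t)ᵀ * diagonal d * of fun t k => ∂ k f x t) := by
  ext j k
  rw [scalarSecondFundamentalForm_eq_neg_inner hf hν hνf, neg_apply, mul_apply]
  simp only [PiLp.inner_apply, hd, mul_diagonal, transpose_apply, of_apply]
  congr 1
  refine Finset.sum_congr rfl fun t _ => ?_
  simp [mul_comm]

theorem scalarCurvature_hypersurface_of_diagonal (hcard : Fintype.card ι = m + 1)
    (hf : ContDiffAt ℝ 3 f x) (hli : LinearIndependent ℝ fun i => ∂ i f x) (hνx : ν x ≠ 0)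
    (hν : DifferentiableAt ℝ ν x) (hνf : ∀ᶠ y in 𝓝 x, ∀ k, ⟪ν y, ∂ k f y⟫_ℝ = 0)
    (hd : ∀ j t, ∂ j ν x t = d t * ∂ j f x t) :
    scalarCurvature (inducedMetric f) x
      = (∑ t, ∑ s ∈ Finset.univ.filter (fun s => t ≠ s),
          d t * d s * (1 - (ν x t ^ 2 + ν x s ^ 2) / ‖ν x‖ ^ 2)) / ‖ν x‖ ^ 2 := by
  have hνfx : ∀ k, ⟪ν x, ∂ k f x⟫_ℝ = 0 := hνf.self_of_nhds
  rw [scalarCurvature_hypersurface (by simpa using hcard) hf hli hνx hνfx,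
    scalarSecondFundamentalForm_of_diagonal (hf.of_le (by norm_num)) hν hνf hd]
  set A : Matrix ι (Fin m) ℝ := of fun t k => ∂ k f x t
  set H := (inducedMetric f x)⁻¹
  have hP : ∀ t s, (A * H * Aᵀ) t s = (1 : Matrix ι ι ℝ) t s - ν x t * ν x s / ‖ν x‖ ^ 2 :=
    mul_gram_inv_mul_transpose_apply (by simpa using hcard) hli hνx hνfx
  rw [neg_mul, neg_mul_neg, trace_neg, neg_sq, trace_sq_sub_trace_transpose_mul_diagonal_mul]
  congr 1
  refine Finset.sum_congr rfl fun t _ => ?_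
  rw [Finset.sum_filter]
  refine Finset.sum_congr rfl fun s _ => ?_
  rcases eq_or_ne t s with rfl | hts
  · simp
  · rw [if_pos hts, hP, hP, hP, hP, one_apply_ne hts, one_apply_ne hts.symm, one_apply_eq,
      one_apply_eq]
    ring

end DiagonalShapeOperator

section SimplexParametrization

theorem injective_fderiv_of_leftInverse {E F : Type*} [NormedAddCommGroup E] [NormedSpace ℝ E]
    [NormedAddCommGroup F] [NormedSpace ℝ F] {ψ : E → F} {T : F →L[ℝ] E}
    (hT : Function.LeftInverse T ψ) {x : E} (hψ : DifferentiableAt ℝ ψ x) :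
    Function.Injective (fderiv ℝ ψ x) := by
  have hcomp : HasFDerivAt (T ∘ ψ) (T ∘L fderiv ℝ ψ x) x :=
    T.hasFDerivAt.comp x hψ.hasFDerivAt
  rw [hT.comp_eq_id] at hcomp
  have hid := hcomp.unique (hasFDerivAt_id x)
  exact Function.LeftInverse.injective (g := T) fun v => DFunLike.congr_fun hid v

variable {m : ℕ}

/-- The global parametrization of the simplex by all probabilities but the first, which is
recovered from the normalization. It is defined on all of coordinate space. -/
def simplexParametrization (x : Fin m → ℝ) : Fin (m + 1) → ℝ :=
  Fin.cons (1 - ∑ i, x i) x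

theorem sum_simplexParametrization (x : Fin m → ℝ) : ∑ k, simplexParametrization x k = 1 := by
  simp [simplexParametrization, Fin.sum_univ_succ]

theorem tail_simplexParametrization (x : Fin m → ℝ) : Fin.tail (simplexParametrization x) = x :=
  rfl

theorem simplexParametrization_tail {θ : Fin (m + 1) → ℝ} (hθ : ∑ k, θ k = 1) :
    simplexParametrization (Fin.tail θ) = θ := by
  rw [Fin.sum_univ_succ, ← eq_sub_iff_add_eq] at hθ
  simp only [simplexParametrization, Fin.tail, ← hθ]
  exact Fin.cons_self_tail θ

theorem contDiff_simplexParametrization :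
    ContDiff ℝ ∞ (simplexParametrization : (Fin m → ℝ) → _) := by
  refine contDiff_pi.2 (Fin.cases ?_ fun i => ?_)
  · simp only [simplexParametrization, Fin.cons_zero]
    fun_prop
  · simp only [simplexParametrization, Fin.cons_succ]
    fun_prop

theorem isLocalParametrization_simplexParametrization :
    IsLocalParametrization (m + 1) (simplexParametrization ⁻¹' simplex (m + 1))
      simplexParametrization where
  isOpen := by
    have hcont := (contDiff_simplexParametrization (m := m)).continuous
    have hU : simplexParametrization ⁻¹' simplex (m + 1)
        = ⋂ k, {x : Fin m → ℝ | 0 < simplexParametrization x k} := by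
      ext x
      simp [simplex, sum_simplexParametrization]
    rw [hU]
    exact isOpen_iInter_of_finite fun k =>
      isOpen_lt continuous_const ((continuous_apply k).comp hcont)
  contDiffOn := contDiff_simplexParametrization.contDiffOn
  injOn := (Function.LeftInverse.injective tail_simplexParametrization).injOn
  mapsTo := Set.mapsTo_preimage _ _
  immersion x _ := injective_fderiv_of_leftInverse
    (T := ContinuousLinearMap.pi fun i => ContinuousLinearMap.proj i.succ) (fun _ => rfl)
    (contDiff_simplexParametrization.differentiable (by simp) x)

theorem exists_isLocalParametrization {n : ℕ} (hn : 1 ≤ n) {θ : Fin n → ℝ} (hθ : θ ∈ simplex n) :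
    ∃ U ψ, IsLocalParametrization n U ψ ∧ ∃ x ∈ U, ψ x = θ := by
  obtain ⟨m, rfl⟩ := Nat.exists_eq_add_of_le' hn
  have htail := simplexParametrization_tail hθ.2
  exact ⟨_, _, isLocalParametrization_simplexParametrization, Fin.tail θ,
    Set.mem_preimage.2 (htail.symm ▸ hθ), htail⟩

end SimplexParametrization

section LocalParametrization

variable {n : ℕ} {U : Set (Fin (n - 1) → ℝ)} {ψ : (Fin (n - 1) → ℝ) → Fin n → ℝ}
  {x : Fin (n - 1) → ℝ}

theorem IsLocalParametrization.contDiffAt (hψ : IsLocalParametrization n U ψ) (hx : x ∈ U) :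
    ContDiffAt ℝ ∞ ψ x :=
  hψ.contDiffOn.contDiffAt (hψ.isOpen.mem_nhds hx)

theorem IsLocalParametrization.differentiableAt (hψ : IsLocalParametrization n U ψ)
    (hx : x ∈ U) : DifferentiableAt ℝ ψ x :=
  (hψ.contDiffAt hx).differentiableAt (by simp)

theorem IsLocalParametrization.sum_vecPartialDeriv (hψ : IsLocalParametrization n U ψ)
    (hx : x ∈ U) (j : Fin (n - 1)) : ∑ k, ∂ j ψ x k = 0 := by
  have hsum : (fun y => ∑ k, ψ y k) =ᶠ[𝓝 x] fun _ => 1 := by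
    filter_upwards [hψ.isOpen.mem_nhds hx] with y hy using (hψ.mapsTo hy).2
  have hderiv := HasFDerivAt.fun_sum (u := Finset.univ) fun k _ =>
    hasFDerivAt_pi'.1 (hψ.differentiableAt hx).hasFDerivAt k
  have hzero := hderiv.unique ((hasFDerivAt_const 1 x).congr_of_eventuallyEq hsum)
  simpa [vecPartialDeriv] using DFunLike.congr_fun hzero (Pi.single j 1)

theorem IsLocalParametrization.linearIndependent_vecPartialDeriv
    (hψ : IsLocalParametrization n U ψ) (hx : x ∈ U) :
    LinearIndependent ℝ fun j => ∂ j ψ x := by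
  simpa [Function.comp_def, vecPartialDeriv] using
    (Pi.basisFun ℝ (Fin (n - 1))).linearIndependent.map' (fderiv ℝ ψ x).toLinearMap
      (LinearMap.ker_eq_bot.2 (hψ.immersion x hx))

end LocalParametrization

section Coordinatewise

variable {ι : Type*} {θ : ι → ℝ} {φ : ι → ℝ → ℝ}

theorem contDiffAt_toLp_comp [Fintype ι] {r : WithTop ℕ∞}
    (hφ : ∀ k, ContDiffAt ℝ r (φ k) (θ k)) :
    ContDiffAt ℝ r (fun θ : ι → ℝ => WithLp.toLp 2 fun k => φ k (θ k)) θ :=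
  contDiffAt_euclidean.2 fun k => (hφ k).comp θ (contDiffAt_pi.1 contDiffAt_id k)

theorem fderiv_toLp_comp_apply [Finite ι] {φ' : ι → ℝ}
    (hφ : ∀ k, HasDerivAt (φ k) (φ' k) (θ k)) (v : ι → ℝ) (k : ι) :
    fderiv ℝ (fun θ : ι → ℝ => WithLp.toLp 2 fun k => φ k (θ k)) θ v k = φ' k * v k := by
  cases nonempty_fintype ι
  have hcoord : HasFDerivAt (fun θ : ι → ℝ => φ k (θ k))
      (φ' k • ContinuousLinearMap.proj (R := ℝ) k) θ :=
    HasDerivAt.comp_hasFDerivAt (f := fun θ : ι → ℝ => θ k) θ (hφ k) (hasFDerivAt_apply k θ)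
  have hdiff : DifferentiableAt ℝ (fun θ : ι → ℝ => WithLp.toLp 2 fun k => φ k (θ k)) θ :=
    differentiableAt_euclidean.2 fun k =>
      (hφ k).differentiableAt.comp θ (differentiableAt_apply k θ)
  have hproj :=
    ((EuclideanSpace.proj (𝕜 := ℝ) k).hasFDerivAt.comp θ hdiff.hasFDerivAt).unique hcoord
  simpa using DFunLike.congr_fun hproj v

end Coordinatewise

section AlphaEmbedding

/-- The `α`-representation of a positive number: the scalar function which `alphaMap α` applies to
each coordinate. -/
def alphaRepresentation (α t : ℝ) : ℝ :=
  if α = 1 then Real.log t else 2 / (1 - α) * t ^ ((1 - α) / 2)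

theorem hasDerivAt_alphaRepresentation (α : ℝ) {t : ℝ} (ht : 0 < t) :
    HasDerivAt (alphaRepresentation α) (t ^ (-((1 + α) / 2))) t := by
  unfold alphaRepresentation
  by_cases h : α = 1
  · subst h
    simp only [if_true]
    convert Real.hasDerivAt_log ht.ne' using 1
    norm_num [Real.rpow_neg_one]
  · simp only [h, if_false]
    have hα : 1 - α ≠ 0 := sub_ne_zero.2 (Ne.symm h)
    refine ((Real.hasDerivAt_rpow_const (Or.inl ht.ne')).const_mul _).congr_deriv ?_
    rw [show (1 - α) / 2 - 1 = -((1 + α) / 2) by ring]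
    field_simp

theorem contDiffAt_alphaRepresentation (α : ℝ) {t : ℝ} (ht : 0 < t) {r : WithTop ℕ∞} :
    ContDiffAt ℝ r (alphaRepresentation α) t := by
  unfold alphaRepresentation
  by_cases h : α = 1
  · simpa only [h, if_true] using Real.contDiffAt_log.2 ht.ne'
  · simpa only [h, if_false] using
      contDiffAt_const.mul (Real.contDiffAt_rpow_const_of_ne ht.ne')

variable {n : ℕ} {θ : Fin n → ℝ}

/-- The map `φ_α` with values in Euclidean space, whose inner product induces the metric
`alphaMetric α`. -/
def alphaEmbedding (α : ℝ) (θ : Fin n → ℝ) : EuclideanSpace ℝ (Fin n) :=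
  WithLp.toLp 2 (alphaMap α θ)

/-- A normal vector, of length `normConst α θ`, to the image of the simplex under
`alphaEmbedding α` at the image of `θ`. -/
def alphaNormal (α : ℝ) (θ : Fin n → ℝ) : EuclideanSpace ℝ (Fin n) :=
  WithLp.toLp 2 fun k => θ k ^ ((1 + α) / 2)

theorem alphaMetric_eq_inner (α : ℝ) (θ a b : Fin n → ℝ) :
    alphaMetric α θ a b
      = ⟪fderiv ℝ (alphaEmbedding α) θ a, fderiv ℝ (alphaEmbedding α) θ b⟫_ℝ := by
  have hfderiv : fderiv ℝ (alphaEmbedding α) θ = _ :=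
    (PiLp.continuousLinearEquiv 2 ℝ fun _ : Fin n => ℝ).symm.comp_fderiv (f := alphaMap α) (x := θ)
  simp [alphaMetric, hfderiv, PiLp.inner_apply, mul_comm]

theorem contDiffAt_alphaEmbedding (α : ℝ) (hθ : ∀ k, 0 < θ k) {r : WithTop ℕ∞} :
    ContDiffAt ℝ r (alphaEmbedding α) θ :=
  contDiffAt_toLp_comp (φ := fun _ => alphaRepresentation α) fun k =>
    contDiffAt_alphaRepresentation α (hθ k)

theorem contDiffAt_alphaNormal (α : ℝ) (hθ : ∀ k, 0 < θ k) {r : WithTop ℕ∞} :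
    ContDiffAt ℝ r (alphaNormal α) θ :=
  contDiffAt_toLp_comp (φ := fun _ t => t ^ ((1 + α) / 2)) fun k =>
    Real.contDiffAt_rpow_const_of_ne (hθ k).ne'

theorem fderiv_alphaEmbedding_apply (α : ℝ) (hθ : ∀ k, 0 < θ k) (v : Fin n → ℝ) (k : Fin n) :
    fderiv ℝ (alphaEmbedding α) θ v k = θ k ^ (-((1 + α) / 2)) * v k :=
  fderiv_toLp_comp_apply (φ := fun _ => alphaRepresentation α)
    (fun k => hasDerivAt_alphaRepresentation α (hθ k)) v k

theorem fderiv_alphaNormal_apply (α : ℝ) (hθ : ∀ k, 0 < θ k) (v : Fin n → ℝ) (k : Fin n) :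
    fderiv ℝ (alphaNormal α) θ v k
      = (1 + α) / 2 * θ k ^ α * fderiv ℝ (alphaEmbedding α) θ v k := by
  have hpow : θ k ^ ((1 + α) / 2 - 1) = θ k ^ α * θ k ^ (-((1 + α) / 2)) := by
    rw [← Real.rpow_add (hθ k)]
    ring_nf
  have hderiv := fderiv_toLp_comp_apply (φ := fun _ t => t ^ ((1 + α) / 2))
    (fun k => Real.hasDerivAt_rpow_const (Or.inl (hθ k).ne')) v k
  rw [fderiv_alphaEmbedding_apply α hθ]
  refine hderiv.trans ?_
  rw [hpow]
  ring

theorem injective_fderiv_alphaEmbedding (α : ℝ) (hθ : ∀ k, 0 < θ k) :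
    Function.Injective (fderiv ℝ (alphaEmbedding α) θ) := by
  refine fun v w hvw => funext fun k => ?_
  have hk := congrArg (fun u : EuclideanSpace ℝ (Fin n) => u k) hvw
  simp only [fderiv_alphaEmbedding_apply α hθ] at hk
  exact mul_left_cancel₀ (Real.rpow_pos_of_pos (hθ k) _).ne' hk

theorem inner_alphaNormal_fderiv_alphaEmbedding (α : ℝ) (hθ : ∀ k, 0 < θ k) (v : Fin n → ℝ) :
    ⟪alphaNormal α θ, fderiv ℝ (alphaEmbedding α) θ v⟫_ℝ = ∑ k, v k := by
  rw [PiLp.inner_apply]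
  refine Finset.sum_congr rfl fun k _ => ?_
  rw [fderiv_alphaEmbedding_apply α hθ, alphaNormal, Real.rpow_neg (hθ k).le]
  have hk := (Real.rpow_pos_of_pos (hθ k) ((1 + α) / 2)).ne'
  simp only [RCLike.inner_apply, Real.ringHom_apply]
  field_simp

theorem alphaNormal_sq (α : ℝ) {k : Fin n} (hθ : 0 ≤ θ k) :
    alphaNormal α θ k ^ 2 = θ k ^ (α + 1) := by
  rw [alphaNormal, ← Real.rpow_mul_natCast hθ]
  ring_nf

theorem norm_alphaNormal (α : ℝ) (hθ : ∀ k, 0 ≤ θ k) : ‖alphaNormal α θ‖ = normConst α θ := by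
  simp only [EuclideanSpace.norm_eq, Real.norm_eq_abs, sq_abs, alphaNormal_sq α (hθ _), normConst]

theorem alphaNormal_ne_zero (α : ℝ) {k : Fin n} (hθ : 0 < θ k) : alphaNormal α θ ≠ 0 := by
  intro hzero
  have hk : θ k ^ ((1 + α) / 2) = 0 := congrArg (fun u : EuclideanSpace ℝ (Fin n) => u k) hzero
  exact (Real.rpow_pos_of_pos hθ _).ne' hk

end AlphaEmbedding

section AlphaMetric

variable {n : ℕ} {U : Set (Fin (n - 1) → ℝ)} {ψ : (Fin (n - 1) → ℝ) → Fin n → ℝ}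
  {x : Fin (n - 1) → ℝ}

theorem vecPartialDeriv_alphaEmbedding_comp (α : ℝ) (hψ : IsLocalParametrization n U ψ)
    (hx : x ∈ U) (j : Fin (n - 1)) :
    ∂ j (alphaEmbedding α ∘ ψ) x = fderiv ℝ (alphaEmbedding α) (ψ x) (∂ j ψ x) :=
  vecPartialDeriv_comp ((contDiffAt_alphaEmbedding α (hψ.mapsTo hx).1).differentiableAt one_ne_zero)
    (hψ.differentiableAt hx) j

theorem metricMatrix_alphaMetric (α : ℝ) (hψ : IsLocalParametrization n U ψ) (hx : x ∈ U) :
    metricMatrix (alphaMetric α) ψ x = inducedMetric (alphaEmbedding α ∘ ψ) x := by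
  ext i j
  simp only [metricMatrix, alphaMetric_eq_inner, inducedMetric, gram_apply,
    vecPartialDeriv_alphaEmbedding_comp α hψ hx]
  rfl

theorem linearIndependent_vecPartialDeriv_alphaEmbedding_comp (α : ℝ)
    (hψ : IsLocalParametrization n U ψ) (hx : x ∈ U) :
    LinearIndependent ℝ fun j => ∂ j (alphaEmbedding α ∘ ψ) x := by
  simp only [vecPartialDeriv_alphaEmbedding_comp α hψ hx]
  exact (hψ.linearIndependent_vecPartialDeriv hx).map'
    (fderiv ℝ (alphaEmbedding α) (ψ x)).toLinearMap
    (LinearMap.ker_eq_bot.2 (injective_fderiv_alphaEmbedding α (hψ.mapsTo hx).1))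

theorem inner_alphaNormal_vecPartialDeriv_alphaEmbedding_comp (α : ℝ)
    (hψ : IsLocalParametrization n U ψ) (hx : x ∈ U) (j : Fin (n - 1)) :
    ⟪alphaNormal α (ψ x), ∂ j (alphaEmbedding α ∘ ψ) x⟫_ℝ = 0 := by
  rw [vecPartialDeriv_alphaEmbedding_comp α hψ hx,
    inner_alphaNormal_fderiv_alphaEmbedding α (hψ.mapsTo hx).1, hψ.sum_vecPartialDeriv hx]

theorem vecPartialDeriv_alphaNormal_comp_apply (α : ℝ) (hψ : IsLocalParametrization n U ψ)
    (hx : x ∈ U) (j : Fin (n - 1)) (k : Fin n) :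
    ∂ j (alphaNormal α ∘ ψ) x k
      = (1 + α) / 2 * ψ x k ^ α * ∂ j (alphaEmbedding α ∘ ψ) x k := by
  have hpos := (hψ.mapsTo hx).1
  rw [vecPartialDeriv_alphaEmbedding_comp α hψ hx, ← fderiv_alphaNormal_apply α hpos,
    vecPartialDeriv_comp ((contDiffAt_alphaNormal α hpos).differentiableAt one_ne_zero)
      (hψ.differentiableAt hx)]

theorem scalarCurvature_metricMatrix_alphaMetric (α : ℝ) (hn : 1 ≤ n)
    (hψ : IsLocalParametrization n U ψ) (hx : x ∈ U) :
    scalarCurvature (metricMatrix (alphaMetric α) ψ) x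
      = (∑ t, ∑ s ∈ Finset.univ.filter (fun s => t ≠ s),
          (1 + α) / 2 * ψ x t ^ α * ((1 + α) / 2 * ψ x s ^ α) *
            (1 - (ψ x t ^ (α + 1) + ψ x s ^ (α + 1)) / normConst α (ψ x) ^ 2))
        / normConst α (ψ x) ^ 2 := by
  have hpos := (hψ.mapsTo hx).1
  have hU : ∀ᶠ y in 𝓝 x, y ∈ U := hψ.isOpen.mem_nhds hx
  have hsmooth : ContDiffAt ℝ 3 ψ x := (hψ.contDiffAt hx).of_le (by norm_cast)
  rw [scalarCurvature_congr (hU.mono fun y hy => metricMatrix_alphaMetric α hψ hy),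
    scalarCurvature_hypersurface_of_diagonal (ν := alphaNormal α ∘ ψ)
      (d := fun t => (1 + α) / 2 * ψ x t ^ α) (by simp only [Fintype.card_fin]; omega)
      ((contDiffAt_alphaEmbedding α hpos).comp x hsmooth)
      (linearIndependent_vecPartialDeriv_alphaEmbedding_comp α hψ hx)
      (alphaNormal_ne_zero α (hpos ⟨0, hn⟩))
      (((contDiffAt_alphaNormal α hpos).comp x hsmooth).differentiableAt (by norm_num))
      (hU.mono fun y hy => inner_alphaNormal_vecPartialDeriv_alphaEmbedding_comp α hψ hy)
      (vecPartialDeriv_alphaNormal_comp_apply α hψ hx)]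
  simp only [Function.comp_apply, alphaNormal_sq α (hpos _).le,
    norm_alphaNormal α fun k => (hpos k).le]

end AlphaMetric

end AlphaGeometry

end

theorem mainTheorem1 (n : ℕ) (hn : 1 ≤ n) (α : ℝ) (θ : Fin n → ℝ)
    (hθ : θ ∈ AlphaGeometry.simplex n) :
    AlphaGeometry.IsScalarCurvatureAt (AlphaGeometry.alphaMetric α) θ
      ((1 + α) ^ 2 / (4 * AlphaGeometry.normConst α θ ^ 2) *
        ∑ t, ∑ s ∈ Finset.univ.filter (fun s => t ≠ s),
          θ t ^ α * θ s ^ α *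
            (1 - (θ t ^ (α + 1) + θ s ^ (α + 1)) / AlphaGeometry.normConst α θ ^ 2)) := by
  refine ⟨AlphaGeometry.exists_isLocalParametrization hn hθ, ?_⟩
  rintro U ψ hψ x hx rfl
  rw [AlphaGeometry.scalarCurvature_metricMatrix_alphaMetric α hn hψ hx, Finset.sum_div,
    Finset.mul_sum]
  refine Finset.sum_congr rfl fun t _ => ?_
  rw [Finset.sum_div, Finset.mul_sum]
  refine Finset.sum_congr rfl fun s _ => ?_
  ring
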